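/- Let $n_1\ge n_2\ge n_3\ge 1$ be integers and let $K_{n_1,n_2,n_3}$ be the complete $3$-partite graph with parts $V_1,V_2,V_3$, $|V_i|=n_i$. A $4$-cycle in $K_{n_1,n_2,n_3}$ is called multipartite, denoted $C_4^{multi}$, if it contains at least one vertex of each of the three parts. In an edge-colouring, it is called rainbow if its four edges have pairwise different colours. Let $\mathrm{ar}(K_{n_1,n_2,n_3},C_4^{multi})$ be the maximum number of colours in an edge-colouring of $K_{n_1,n_2,n_3}$ with no rainbow $C_4^{multi}$, and let $\mathrm{ex}(K_{n_1,n_2,n_3},\{C_3,C_4^{multi}\})$ be the maximum number of edges of a subgraph of $K_{n_1,n_2,n_3}$ that contains neither a triangle nor a $C_4^{multi}$. Then $$\mathrm{ar}(K_{n_1,n_2,n_3},C_4^{multi})=n_1n_2+n_3+1=\mathrm{ex}(K_{n_1,n_2,n_3},\{C_3,C_4^{multi}\})+1 .$$ -/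

import Mathlib

namespace TripartiteC4

open SimpleGraph

/-- The complete `3`-partite graph with the parts `V 0`, `V 1`, `V 2`. A vertex is a pair `⟨i, x⟩`
with `x` in the part `V i`; two vertices are adjacent iff they lie in different parts. -/
abbrev completeTripartite (V : Fin 3 → Type*) : SimpleGraph (Σ i, V i) :=
  completeMultipartiteGraph V

/-- A copy of the `4`-cycle in a `3`-partite graph is multipartite if it has at least one vertex in
each of the three parts. -/
def IsMultipartite {V : Fin 3 → Type*} {G : SimpleGraph (Σ i, V i)}
    (f : Copy (cycleGraph 4) G) : Prop :=
  ∀ i : Fin 3, ∃ j : Fin 4, (f j).1 = i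

/-- A copy of a graph `H` in an edge-coloured graph `G` is rainbow if its edges have pairwise
different colours. -/
def IsRainbow {α β C : Type*} {H : SimpleGraph α} {G : SimpleGraph β} (c : G.edgeSet → C)
    (f : Copy H G) : Prop :=
  Function.Injective fun e : H.edgeSet => c (f.toHom.mapEdgeSet e)

/-- The numbers of colours actually used by edge-colourings of the complete `3`-partite graph that
have no rainbow multipartite `4`-cycle. -/
def rainbowFreeColorCounts (V : Fin 3 → Type*) : Set ℕ :=
  {k | ∃ c : (completeTripartite V).edgeSet → ℕ,
    (¬ ∃ f : Copy (cycleGraph 4) (completeTripartite V), IsMultipartite f ∧ IsRainbow c f) ∧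
      (Set.range c).ncard = k}

/-- The anti-Ramsey number of the multipartite `4`-cycle in the complete `3`-partite graph. -/
noncomputable def ar (V : Fin 3 → Type*) : ℕ :=
  sSup (rainbowFreeColorCounts V)

/-- The numbers of edges of subgraphs of the complete `3`-partite graph that contain neither a
triangle nor a multipartite `4`-cycle. -/
def freeEdgeCounts (V : Fin 3 → Type*) : Set ℕ :=
  {m | ∃ G : SimpleGraph (Σ i, V i), G ≤ completeTripartite V ∧ (cycleGraph 3).Free G ∧
    (¬ ∃ f : Copy (cycleGraph 4) G, IsMultipartite f) ∧ G.edgeSet.ncard = m}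

/-- The Turán number of the family consisting of the triangle and the multipartite `4`-cycle in the
complete `3`-partite graph. -/
noncomputable def ex (V : Fin 3 → Type*) : ℕ :=
  sSup (freeEdgeCounts V)

/-- For finite parts the supremum defining `ar` is an attained maximum. -/
theorem ar_isGreatest (V : Fin 3 → Type*) [∀ i, Finite (V i)] :
    IsGreatest (rainbowFreeColorCounts V) (ar V) := by
  have hb : BddAbove (rainbowFreeColorCounts V) := by
    refine ⟨Nat.card (completeTripartite V).edgeSet, ?_⟩
    rintro _ ⟨c, -, rfl⟩
    rw [← Nat.card_coe_set_eq]
    exact Finite.card_range_le c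
  refine ⟨Nat.sSup_mem ⟨_, fun _ => 0, ?_, rfl⟩ hb, fun k hk => le_csSup hb hk⟩
  rintro ⟨f, -, hf⟩
  have h := @hf ⟨s(0, 1), by simp [cycleGraph_adj]⟩ ⟨s(1, 2), by simp [cycleGraph_adj]⟩ rfl
  simp at h

/-- For finite parts the supremum defining `ex` is an attained maximum. -/
theorem ex_isGreatest (V : Fin 3 → Type*) [∀ i, Finite (V i)] :
    IsGreatest (freeEdgeCounts V) (ex V) := by
  have hb : BddAbove (freeEdgeCounts V) := by
    refine ⟨(completeTripartite V).edgeSet.ncard, ?_⟩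
    rintro _ ⟨G, hG, -, -, rfl⟩
    exact Set.ncard_le_ncard (edgeSet_mono hG) (Set.toFinite _)
  refine ⟨Nat.sSup_mem ⟨_, ⊥, bot_le, ?_, ?_, rfl⟩ hb, fun k hk => le_csSup hb hk⟩
  · rintro ⟨f⟩
    have h : (cycleGraph 3).Adj 0 1 := by simp [cycleGraph_adj]
    exact f.toHom.map_adj h
  · rintro ⟨f, -⟩
    have h : (cycleGraph 4).Adj 0 1 := by simp [cycleGraph_adj]
    exact f.toHom.map_adj h

end TripartiteC4

/-!
The colours and the edges are counted by one inequality for a tripartite graph `G` with parts `A`,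
`B`, `C`, where `C` is a smallest part. In the anti-Ramsey problem `G` consists of one edge of each
colour, in the Turán problem it is the given graph. A multipartite `4`-cycle always has the form
`a – b – a' – c` with `a`, `a'` in one part and `b`, `c` in the other two, so in both cases a vertex
of `B` and a vertex of `C` have at most one common neighbour in `A`, and likewise for the other
parts. Say that `(b, c)` is covered once by the edge `bc` and once by each common neighbour in `A`.
Then `G` is *sparse*: the total number of coverings, `e(B, C) + ∑ a, d_B(a) d_C(a)`, is at most
`|B| |C| + τ`, with `τ = 0` in the Turán problem and `τ = 1` in the anti-Ramsey problem, also for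
subsets of the parts and for the other orders of the parts.

For `τ = 0` this is clear, as there are no triangles. For `τ = 1` the pairs covered twice come from
triangles of `G`. The colouring makes these triangles vertex-disjoint, and of the two pairs
`(b₁, c₂)`, `(b₂, c₁)` formed from two triangles at least one is uncovered
(`IsRainbowSubgraph.not_isCovered`), so that `t` triangles come with at least `t - 1` uncovered
pairs (`IsRainbowSubgraph.edges_add_paths_le`).

A sparse graph has at most `|A| |B| + |C| + τ` edges (`Sparse.edgesAcross_le`), by induction on the
number of vertices. If `|C| < |A|`, the rectangles `N_B(a) × N_C(a)` are disjoint and too few pairs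
exist for all `a` to have degree above `|B|`; remove a vertex of degree at most `|B|`. If all parts
have size `n`, removing vertices from two or from three parts shows that all pairs and triples of
vertices of a counterexample are incident with many edges. If the vertices of some part all have
neighbours in both other parts, then `d_B + d_C ≤ d_B d_C + 1` there and sparsity gives the bound.
Otherwise each part has a vertex with neighbours in only one other part, these adjacencies go round
the parts cyclically, and the large neighbourhoods of these three vertices leave room for at most
`(n - 1) (n + 2)` edges.

The bounds are attained by `extremalColour` and `extremalGraph`.
-/

namespace TripartiteC4

open SimpleGraph Finset

/-! ### Edge counts in sparse tripartite graphs -/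

section Graph

variable {W : Type*} (G : SimpleGraph W)

open scoped Classical in
/-- The number of neighbours of the vertex `v` in the finite vertex set `S`. -/
noncomputable def degInto (v : W) (S : Finset W) : ℕ :=
  #{w ∈ S | G.Adj v w}

open scoped Classical in
/-- The set of common neighbours of `b` and `c` in the finite vertex set `A`. -/
noncomputable def commonIn (A : Finset W) (b c : W) : Finset W :=
  {a ∈ A | G.Adj b a ∧ G.Adj c a}

/-- The number of edges between `A` and `B`, counted from the side of `A`. -/
noncomputable def edgesBetween (A B : Finset W) : ℕ :=
  ∑ a ∈ A, degInto G a B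

/-- The number of edges of `G` that join two of the three vertex sets `A`, `B`, `C`. -/
noncomputable def edgesAcross (A B C : Finset W) : ℕ :=
  edgesBetween G A B + edgesBetween G A C + edgesBetween G B C

variable {G}

lemma degInto_le_card (v : W) (S : Finset W) : degInto G v S ≤ #S := by
  classical exact card_filter_le _ _

lemma degInto_mono (v : W) {S T : Finset W} (h : S ⊆ T) : degInto G v S ≤ degInto G v T := by
  classical exact card_le_card (filter_subset_filter _ h)

lemma commonIn_mono {A A' : Finset W} (h : A' ⊆ A) (b c : W) :
    commonIn G A' b c ⊆ commonIn G A b c := by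
  classical exact filter_subset_filter _ h

lemma commonIn_comm (A : Finset W) (b c : W) : commonIn G A b c = commonIn G A c b := by
  ext; simp [commonIn, and_comm]

lemma edgesBetween_comm (A B : Finset W) : edgesBetween G A B = edgesBetween G B A := by
  classical
  have := sum_card_bipartiteAbove_eq_sum_card_bipartiteBelow (s := A) (t := B) G.Adj
  simp only [bipartiteAbove, bipartiteBelow] at this
  simp only [edgesBetween, degInto]
  rw [this]
  exact sum_congr rfl fun b _ => congrArg card (filter_congr fun a _ => G.adj_comm a b)

lemma edgesBetween_le (A B : Finset W) : edgesBetween G A B ≤ #A * #B := by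
  simpa [edgesBetween] using sum_le_card_nsmul A _ _ fun a _ => degInto_le_card (G := G) a B

lemma edgesAcross_swap (A B C : Finset W) : edgesAcross G A B C = edgesAcross G B A C := by
  simp only [edgesAcross, edgesBetween_comm A B]; ring

lemma edgesAcross_rotate (A B C : Finset W) : edgesAcross G A B C = edgesAcross G B C A := by
  simp only [edgesAcross, edgesBetween_comm A B, edgesBetween_comm A C]; ring

lemma edgesAcross_erase [DecidableEq W] {A : Finset W} (B C : Finset W) {a : W} (ha : a ∈ A) :
    edgesAcross G A B C =
      edgesAcross G (A.erase a) B C + (degInto G a B + degInto G a C) := by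
  simp only [edgesAcross, edgesBetween]
  rw [← sum_erase_add A _ ha, ← sum_erase_add A _ ha]
  ring

/-- Two vertices with few common neighbours in `A` have few neighbours in `A` altogether. -/
lemma degInto_add_degInto_le (A : Finset W) (b c : W) :
    degInto G b A + degInto G c A ≤ #A + #(commonIn G A b c) := by
  classical
  simp only [degInto, commonIn]
  rw [← card_union_add_card_inter, ← filter_or, ← filter_and]
  gcongr
  exact filter_subset _ _

/-- Counting the paths `b – a – c` by their midpoint `a` and by their ends. -/
lemma sum_degInto_mul_degInto (A B C : Finset W) :
    ∑ a ∈ A, degInto G a B * degInto G a C = ∑ b ∈ B, ∑ c ∈ C, #(commonIn G A b c) := by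
  classical
  simp only [degInto, commonIn, card_filter, sum_mul_sum]
  rw [sum_comm]
  refine sum_congr rfl fun b _ => ?_
  rw [sum_comm]
  refine sum_congr rfl fun c _ => sum_congr rfl fun a _ => ?_
  by_cases h : G.Adj a b <;> by_cases h' : G.Adj a c <;> simp [h, h', G.adj_comm b, G.adj_comm c]

variable (G) in
/-- The local sparsity conditions seen from the part `A`: a vertex of `B` and a vertex of `C` have
at most one common neighbour in `A`, and between any subsets of the three parts the edges from `B`
to `C` and the paths `b – a – c` together outnumber the pairs `(b, c)` by at most `τ`. -/
structure SparseAt (τ : ℕ) (A B C : Finset W) : Prop where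
  card_common_le : ∀ b ∈ B, ∀ c ∈ C, #(commonIn G A b c) ≤ 1
  edges_add_paths_le : ∀ A' ⊆ A, ∀ B' ⊆ B, ∀ C' ⊆ C,
    edgesBetween G B' C' + ∑ a ∈ A', degInto G a B' * degInto G a C' ≤ #B' * #C' + τ

variable {τ : ℕ} {A B C A' B' C' : Finset W}

lemma SparseAt.swap (h : SparseAt G τ A B C) : SparseAt G τ A C B where
  card_common_le c hc b hb := by
    rw [commonIn_comm]; exact h.card_common_le b hb c hc
  edges_add_paths_le A' hA C' hC B' hB := by
    rw [edgesBetween_comm, mul_comm #C']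
    simpa only [mul_comm] using h.edges_add_paths_le A' hA B' hB C' hC

lemma SparseAt.mono (h : SparseAt G τ A B C) (hA : A' ⊆ A) (hB : B' ⊆ B) (hC : C' ⊆ C) :
    SparseAt G τ A' B' C' where
  card_common_le b hb c hc :=
    (card_le_card (commonIn_mono hA b c)).trans (h.card_common_le b (hB hb) c (hC hc))
  edges_add_paths_le A'' hA' B'' hB' C'' hC' :=
    h.edges_add_paths_le A'' (hA'.trans hA) B'' (hB'.trans hB) C'' (hC'.trans hC)

lemma SparseAt.sum_degInto_mul_le (h : SparseAt G τ A B C) :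
    ∑ a ∈ A, degInto G a B * degInto G a C ≤ #B * #C := by
  rw [sum_degInto_mul_degInto]
  calc _ ≤ ∑ b ∈ B, ∑ c ∈ C, 1 :=
        sum_le_sum fun b hb => sum_le_sum fun c hc => h.card_common_le b hb c hc
    _ = _ := by simp

lemma SparseAt.degInto_add_le (h : SparseAt G τ A B C) {b c : W} (hb : b ∈ B) (hc : c ∈ C) :
    degInto G b A + degInto G c A ≤ #A + 1 :=
  (degInto_add_degInto_le A b c).trans (by gcongr; exact h.card_common_le b hb c hc)

variable (G) in
/-- The sparsity conditions of `SparseAt`, from each of the three parts. -/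
structure Sparse (τ : ℕ) (A B C : Finset W) : Prop where
  left : SparseAt G τ A B C
  middle : SparseAt G τ B A C
  right : SparseAt G τ C A B

lemma Sparse.swap (h : Sparse G τ A B C) : Sparse G τ B A C :=
  ⟨h.middle, h.left, h.right.swap⟩

lemma Sparse.rotate (h : Sparse G τ A B C) : Sparse G τ B C A :=
  ⟨h.middle.swap, h.right.swap, h.left⟩

lemma Sparse.mono (h : Sparse G τ A B C) (hA : A' ⊆ A) (hB : B' ⊆ B) (hC : C' ⊆ C) :
    Sparse G τ A' B' C' :=
  ⟨h.left.mono hA hB hC, h.middle.mono hB hA hC, h.right.mono hC hA hB⟩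

/-- A part larger than the smallest one has a vertex whose removal costs few edges: otherwise there
are too many paths through this part for the rectangles `N_B(a) × N_C(a)` to be disjoint. -/
lemma SparseAt.exists_degInto_add_le (h : SparseAt G τ A B C) (hC : 0 < #C) (hCB : #C ≤ #B)
    (hCA : #C < #A) : ∃ a ∈ A, degInto G a B + degInto G a C ≤ #B := by
  by_contra! hcon
  have h1 : #A * #B ≤ ∑ a ∈ A, degInto G a B * degInto G a C := by
    rw [← smul_eq_mul]
    refine card_nsmul_le_sum A _ _ fun a ha => ?_
    have hd := hcon a ha
    have hB := degInto_le_card (G := G) a B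
    have hC' := degInto_le_card (G := G) a C
    obtain ⟨p, hp⟩ := Nat.exists_eq_add_of_lt (show 0 < degInto G a B by omega)
    obtain ⟨q, hq⟩ := Nat.exists_eq_add_of_lt (show 0 < degInto G a C by omega)
    rw [hp, hq] at hd ⊢
    nlinarith [Nat.zero_le (p * q)]
  have h2 := h1.trans h.sum_degInto_mul_le
  nlinarith

/-- If every vertex of `A` has neighbours in both other parts, then `d_B + d_C ≤ d_B d_C + 1` on
`A`, so that the inequality for edges and paths bounds the number of edges. -/
lemma SparseAt.edgesAcross_le (h : SparseAt G τ A B C)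
    (hpos : ∀ a ∈ A, 0 < degInto G a B ∧ 0 < degInto G a C) :
    edgesAcross G A B C ≤ #B * #C + #A + τ := by
  have h1 := h.edges_add_paths_le A subset_rfl B subset_rfl C subset_rfl
  have h2 : edgesBetween G A B + edgesBetween G A C ≤
      ∑ a ∈ A, degInto G a B * degInto G a C + #A := by
    rw [edgesBetween, edgesBetween, ← sum_add_distrib, card_eq_sum_ones, ← sum_add_distrib]
    refine sum_le_sum fun a ha => ?_
    obtain ⟨p, hp⟩ := Nat.exists_eq_add_of_lt (hpos a ha).1
    obtain ⟨q, hq⟩ := Nat.exists_eq_add_of_lt (hpos a ha).2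
    rw [hp, hq]
    nlinarith [Nat.zero_le (p * q)]
  rw [edgesAcross]
  omega

/-- A vertex `a` of `A` with many neighbours in `C` forces few edges between `B` and `C`; the
vertex `b₀` without neighbours in `C` saves one row of the count. -/
lemma SparseAt.edgesBetween_le_of_degInto_eq_zero (h : SparseAt G τ C A B) {a b₀ : W} (ha : a ∈ A)
    (hb₀ : b₀ ∈ B) (hz : degInto G b₀ C = 0) :
    edgesBetween G B C ≤ (#B - 1) * (#C + 1 - degInto G a C) := by
  classical
  rw [edgesBetween, ← sum_erase_add B _ hb₀, hz, add_zero, ← card_erase_of_mem hb₀, ← smul_eq_mul]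
  refine sum_le_card_nsmul _ _ _ fun b hb => ?_
  have := h.degInto_add_le ha (mem_of_mem_erase hb)
  omega

variable (G τ) in
/-- The bound `|A| |B| + |C| + τ` on the number of edges holds for all sparse triples with fewer
than `m` vertices whose last part is a smallest one. -/
def BoundBelow (m : ℕ) : Prop :=
  ∀ A B C : Finset W, Sparse G τ A B C → #C ≤ #A → #C ≤ #B → #A + #B + #C < m →
    edgesAcross G A B C ≤ #A * #B + #C + τ

/-- In a minimal counterexample with parts of size `n`, removing `a` and `b` destroys at least
`n + 2` edges, of which at most `n + 1` lead to `C`, since `a` and `b` have at most one common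
neighbour there. So `a` has a neighbour in `B`, or `b` has one in `A`. -/
lemma Sparse.degInto_add_pos {n : ℕ} (h : Sparse G τ A B C) (hA : #A = n) (hB : #B = n)
    (hC : #C = n) (ih : BoundBelow G τ (3 * n))
    (hcon : n * n + n + τ < edgesAcross G A B C) {a b : W} (ha : a ∈ A) (hb : b ∈ B) :
    0 < degInto G a B + degInto G b A := by
  classical
  have hA' := card_erase_of_mem ha
  have hB' := card_erase_of_mem hb
  have hpos : 0 < n := hA ▸ card_pos.2 ⟨a, ha⟩
  have h1 := ih C (A.erase a) (B.erase b)
    (h.rotate.rotate.mono subset_rfl (erase_subset _ _) (erase_subset _ _))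
    (by omega) (by omega) (by omega)
  rw [edgesAcross_rotate] at h1
  have h2 := edgesAcross_erase B C ha (G := G)
  have h2' := edgesAcross_erase (A.erase a) C hb (G := G)
  rw [edgesAcross_swap B, edgesAcross_swap (B.erase b)] at h2'
  have h3 := degInto_mono (G := G) b (erase_subset a A)
  have h4 := h.right.degInto_add_le ha hb
  obtain ⟨k, rfl⟩ : ∃ k, n = k + 1 := ⟨n - 1, by omega⟩
  rw [hA', hB', hA, hB, hC] at h1
  simp only [Nat.add_sub_cancel] at h1
  nlinarith

/-- In a minimal counterexample with parts of size `n`, removing a vertex from each part destroys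
more than `2 n` edges, the difference of the two bounds. -/
lemma Sparse.lt_sum_degInto {n : ℕ} (h : Sparse G τ A B C) (hA : #A = n) (hB : #B = n)
    (hC : #C = n) (ih : BoundBelow G τ (3 * n))
    (hcon : n * n + n + τ < edgesAcross G A B C) {a b c : W} (ha : a ∈ A) (hb : b ∈ B)
    (hc : c ∈ C) :
    2 * n < degInto G a B + degInto G a C + (degInto G b A + degInto G b C) +
      (degInto G c A + degInto G c B) := by
  classical
  have hA' := card_erase_of_mem ha
  have hB' := card_erase_of_mem hb
  have hC' := card_erase_of_mem hc
  have hpos : 0 < n := hA ▸ card_pos.2 ⟨a, ha⟩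
  have h1 := ih (C.erase c) (A.erase a) (B.erase b)
    (h.rotate.rotate.mono (erase_subset _ _) (erase_subset _ _) (erase_subset _ _))
    (by omega) (by omega) (by omega)
  have h2 := edgesAcross_erase B C ha (G := G)
  have h2' := edgesAcross_erase C (A.erase a) hb (G := G)
  have h2'' := edgesAcross_erase (A.erase a) (B.erase b) hc (G := G)
  rw [← edgesAcross_rotate, edgesAcross_rotate (B.erase b)] at h2'
  have h3 := degInto_mono (G := G) b (erase_subset a A)
  have h4 := degInto_mono (G := G) c (erase_subset a A)
  have h5 := degInto_mono (G := G) c (erase_subset b B)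
  obtain ⟨k, rfl⟩ : ∃ k, n = k + 1 := ⟨n - 1, by omega⟩
  rw [hA', hB', hC', hA, hB, hC] at h1
  simp only [Nat.add_sub_cancel] at h1
  nlinarith

/-- In a minimal counterexample with parts of equal size, every vertex of `A` has a neighbour in
`B`, provided that every part has a vertex without neighbours in one of the other parts: if `a` had no
neighbour in `B`, the missing adjacencies would go round the three parts cyclically, and the sparsity conditions
bound the number of edges by `(n - 1) (n + 2)`. -/
lemma Sparse.degInto_pos_of_exists_eq_zero {n : ℕ} (h : Sparse G τ A B C) (hA : #A = n)
    (hB : #B = n) (hC : #C = n) (ih : BoundBelow G τ (3 * n))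
    (hcon : n * n + n + τ < edgesAcross G A B C)
    (hzB : ∃ b ∈ B, degInto G b A = 0 ∨ degInto G b C = 0)
    (hzC : ∃ c ∈ C, degInto G c A = 0 ∨ degInto G c B = 0) {a : W} (ha : a ∈ A) :
    0 < degInto G a B := by
  by_contra! hza
  obtain ⟨b, hb, hzb⟩ := hzB
  obtain ⟨c, hc, hzc⟩ := hzC
  have h1 := h.degInto_add_pos hA hB hC ih hcon ha hb
  have hzb' : degInto G b C = 0 := by omega
  have h2 := h.rotate.degInto_add_pos hB hC hA ih (by rwa [← edgesAcross_rotate]) hb hc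
  have hzc' : degInto G c A = 0 := by omega
  have hza' : degInto G a B = 0 := by omega
  -- the three nonzero degrees of `a`, `b`, `c` have a sum above `2 n`, and each of them limits
  -- the number of edges between two parts
  have h3 := h.lt_sum_degInto hA hB hC ih hcon ha hb hc
  have e1 := h.right.edgesBetween_le_of_degInto_eq_zero ha hb hzb'
  have e2 := h.left.edgesBetween_le_of_degInto_eq_zero hb hc hzc'
  have e3 := h.middle.swap.edgesBetween_le_of_degInto_eq_zero hc ha hza'
  have l1 := degInto_le_card (G := G) a C
  have l2 := degInto_le_card (G := G) b A
  have l3 := degInto_le_card (G := G) c B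
  rw [edgesAcross, edgesBetween_comm A C] at hcon
  have hpos : 0 < n := hA ▸ card_pos.2 ⟨a, ha⟩
  rw [hA, hB, hC] at *
  obtain ⟨k, rfl⟩ : ∃ k, n = k + 1 := ⟨n - 1, by omega⟩
  simp only [Nat.add_sub_cancel] at e1 e2 e3
  have e4 : k * (k + 1 + 1 - degInto G a C) + k * (k + 1 + 1 - degInto G b A) +
      k * (k + 1 + 1 - degInto G c B) ≤ k * (k + 3) := by
    rw [← mul_add, ← mul_add]
    exact Nat.mul_le_mul_left _ (by omega)
  nlinarith

lemma Sparse.edgesAcross_le_of_card_eq {n : ℕ} (h : Sparse G τ A B C) (hA : #A = n) (hB : #B = n)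
    (hC : #C = n) (ih : BoundBelow G τ (3 * n)) : edgesAcross G A B C ≤ n * n + n + τ := by
  by_contra! hcon
  have key : ∀ {A B C : Finset W}, Sparse G τ A B C → #A = n → #B = n → #C = n →
      n * n + n + τ < edgesAcross G A B C →
      ∃ a ∈ A, degInto G a B = 0 ∨ degInto G a C = 0 := by
    intro A B C h hA hB hC hcon
    by_contra! hpos
    have := h.left.edgesAcross_le fun a ha =>
      ⟨Nat.pos_of_ne_zero (hpos a ha).1, Nat.pos_of_ne_zero (hpos a ha).2⟩
    rw [hA, hB, hC] at this
    omega
  have hconB : n * n + n + τ < edgesAcross G B A C := by rwa [edgesAcross_swap]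
  have hconC : n * n + n + τ < edgesAcross G C A B := by rwa [edgesAcross_rotate]
  have hconA : n * n + n + τ < edgesAcross G A C B := by rwa [edgesAcross_swap]
  have zA := key h hA hB hC hcon
  have zB := key h.swap hB hA hC hconB
  have zC := key h.rotate.rotate hC hA hB hconC
  obtain ⟨a, ha, hza | hza⟩ := zA
  · exact (h.degInto_pos_of_exists_eq_zero hA hB hC ih hcon zB zC ha).ne' hza
  · refine (h.rotate.rotate.swap.degInto_pos_of_exists_eq_zero hA hC hB ih hconA ?_ ?_ ha).ne' hza
    · exact zC
    · exact zB

/-- A sparse tripartite graph whose smallest part is `C` has at most `|A| |B| + |C| + τ` edges. -/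
theorem Sparse.edgesAcross_le (h : Sparse G τ A B C) (hCA : #C ≤ #A) (hCB : #C ≤ #B) :
    edgesAcross G A B C ≤ #A * #B + #C + τ := by
  suffices H : ∀ m, BoundBelow G τ m from H _ A B C h hCA hCB (Nat.lt_succ_self _)
  classical
  intro m
  induction m with
  | zero => intro A B C _ _ _ h; omega
  | succ m ih =>
    intro A B C h hCA hCB hm
    -- the part `C` is smaller than `A`, up to exchanging `A` and `B`
    have step : ∀ A B : Finset W, Sparse G τ A B C → #C < #A → #C ≤ #B → 0 < #C →
        #A + #B + #C < m + 1 → edgesAcross G A B C ≤ #A * #B + #C + τ := by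
      intro A B h hCA hCB hC hm
      obtain ⟨a, ha, hd⟩ := h.left.exists_degInto_add_le hC hCB hCA
      have hA' := card_erase_of_mem ha
      have h1 := ih (A.erase a) B C (h.mono (erase_subset _ _) subset_rfl subset_rfl)
        (by omega) hCB (by omega)
      rw [edgesAcross_erase B C ha]
      obtain ⟨k, hk⟩ : ∃ k, #A = k + 1 := ⟨#A - 1, by omega⟩
      rw [hA', hk, Nat.add_sub_cancel] at h1
      rw [hk]
      nlinarith
    rcases Nat.eq_zero_or_pos #C with hC | hC
    · have h1 := edgesBetween_le (G := G) A B
      have h2 := edgesBetween_le (G := G) A C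
      have h3 := edgesBetween_le (G := G) B C
      rw [hC, mul_zero] at h2 h3
      rw [edgesAcross]
      omega
    rcases hCA.lt_or_eq with hlt | hA
    · exact step A B h hlt hCB hC hm
    rcases hCB.lt_or_eq with hlt | hB
    · rw [edgesAcross_swap, mul_comm]
      exact step B A h.swap hlt hCA hC (by omega)
    have := h.edgesAcross_le_of_card_eq hA.symm hB.symm rfl
      fun A' B' C' h' h1 h2 h3 => ih A' B' C' h' h1 h2 (by omega)
    rwa [← hA, ← hB]

variable {K : Type*} {col : Sym2 W → K}

/-! ### Rainbow subgraphs -/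

/-- No `4`-cycle `a – b – a' – c` with `a, a'` in `A`, `b` in `B` and `c` in `C` is rainbow. -/
def RainbowFreeAt (col : Sym2 W → K) (A B C : Finset W) : Prop :=
  ∀ a ∈ A, ∀ a' ∈ A, a ≠ a' → ∀ b ∈ B, ∀ c ∈ C,
    ¬ [col s(a, b), col s(a', b), col s(a, c), col s(a', c)].Nodup

lemma RainbowFreeAt.swap (h : RainbowFreeAt col A B C) : RainbowFreeAt col A C B := by
  intro a ha a' ha' hne c hc b hb hnd
  refine h a ha a' ha' hne b hb c hc ?_
  simp only [List.nodup_cons, List.mem_cons, List.not_mem_nil, or_false, not_or] at hnd ⊢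
  tauto

/-- `G` is a rainbow subgraph for a colouring of the edges between the disjoint parts `A`, `B`, `C`
without rainbow multipartite `4`-cycles. -/
structure IsRainbowSubgraph (G : SimpleGraph W) (col : Sym2 W → K) (A B C : Finset W) :
    Prop where
  injOn : Set.InjOn col G.edgeSet
  disj_left : ∀ a ∈ A, ∀ b ∈ B, a ≠ b
  disj_middle : ∀ b ∈ B, ∀ c ∈ C, b ≠ c
  disj_right : ∀ a ∈ A, ∀ c ∈ C, a ≠ c
  left : RainbowFreeAt col A B C
  middle : RainbowFreeAt col B A C
  right : RainbowFreeAt col C A B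

lemma IsRainbowSubgraph.swap (h : IsRainbowSubgraph G col A B C) :
    IsRainbowSubgraph G col B A C :=
  ⟨h.injOn, fun b hb a ha => (h.disj_left a ha b hb).symm, h.disj_right, h.disj_middle,
    h.middle, h.left, h.right.swap⟩

lemma IsRainbowSubgraph.rotate (h : IsRainbowSubgraph G col A B C) :
    IsRainbowSubgraph G col B C A :=
  ⟨h.injOn, h.disj_middle, fun c hc a ha => (h.disj_right a ha c hc).symm,
    fun b hb a ha => (h.disj_left a ha b hb).symm, h.middle.swap, h.right.swap, h.left⟩

lemma IsRainbowSubgraph.mono (h : IsRainbowSubgraph G col A B C) (hA : A' ⊆ A) (hB : B' ⊆ B)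
    (hC : C' ⊆ C) : IsRainbowSubgraph G col A' B' C' where
  injOn := h.injOn
  disj_left a ha b hb := h.disj_left a (hA ha) b (hB hb)
  disj_middle b hb c hc := h.disj_middle b (hB hb) c (hC hc)
  disj_right a ha c hc := h.disj_right a (hA ha) c (hC hc)
  left a ha a' ha' hne b hb c hc := h.left a (hA ha) a' (hA ha') hne b (hB hb) c (hC hc)
  middle b hb b' hb' hne a ha c hc := h.middle b (hB hb) b' (hB hb') hne a (hA ha) c (hC hc)
  right c hc c' hc' hne a ha b hb := h.right c (hC hc) c' (hC hc') hne a (hA ha) b (hB hb)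

/-- Distinct edges of a rainbow subgraph have distinct colours. -/
lemma IsRainbowSubgraph.nodup_map (h : IsRainbowSubgraph G col A B C) {l : List (Sym2 W)}
    (hl : l.Nodup) (hG : ∀ e ∈ l, e ∈ G.edgeSet) : (l.map col).Nodup :=
  hl.map_on fun x hx y hy hxy => h.injOn (hG x hx) (hG y hy) hxy

lemma IsRainbowSubgraph.eq_of_adj (h : IsRainbowSubgraph G col A B C) {a a' b c : W} (ha : a ∈ A)
    (ha' : a' ∈ A) (hb : b ∈ B) (hc : c ∈ C) (hab : G.Adj a b) (hab' : G.Adj a' b)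
    (hac : G.Adj a c) (hac' : G.Adj a' c) : a = a' := by
  by_contra hne
  have h1 := h.disj_left a ha b hb
  have h2 := h.disj_left a' ha' b hb
  have h3 := h.disj_right a ha c hc
  have h4 := h.disj_middle b hb c hc
  refine h.left a ha a' ha' hne b hb c hc
    (h.nodup_map (l := [s(a, b), s(a', b), s(a, c), s(a', c)]) ?_ ?_)
  · simp only [List.nodup_cons, List.mem_cons, List.not_mem_nil, Sym2.eq_iff]
    grind
  · simp [hab, hab', hac, hac']

lemma IsRainbowSubgraph.card_commonIn_le (h : IsRainbowSubgraph G col A B C) {b c : W}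
    (hb : b ∈ B) (hc : c ∈ C) : #(commonIn G A b c) ≤ 1 := by
  refine card_le_one.2 fun a ha a' ha' => ?_
  simp only [commonIn, mem_filter] at ha ha'
  exact h.eq_of_adj ha.1 ha'.1 hb hc ha.2.1.symm ha'.2.1.symm ha.2.2.symm ha'.2.2.symm

/-- The vertices `a`, `b`, `c` of the three parts form a triangle of `G`. -/
structure IsTriangle (G : SimpleGraph W) (A B C : Finset W) (a b c : W) : Prop where
  mem_left : a ∈ A
  mem_middle : b ∈ B
  mem_right : c ∈ C
  adj_left : G.Adj a b
  adj_middle : G.Adj b c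
  adj_right : G.Adj a c

lemma IsTriangle.swap {a b c : W} (h : IsTriangle G A B C a b c) : IsTriangle G B A C b a c :=
  ⟨h.2, h.1, h.3, h.4.symm, h.6, h.5⟩

lemma IsTriangle.rotate {a b c : W} (h : IsTriangle G A B C a b c) : IsTriangle G B C A b c a :=
  ⟨h.2, h.3, h.1, h.5, h.6.symm, h.4.symm⟩

variable {a₁ b₁ c₁ a₂ b₂ c₂ : W}

/-! ### Pairs of triangles in a rainbow subgraph -/

/-- Two triangles that share exactly the vertex `c` leave no colour for the edge `a₁ b₂`. -/
lemma IsRainbowSubgraph.false_of_common_vertex (h : IsRainbowSubgraph G col A B C) {c : W}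
    (t₁ : IsTriangle G A B C a₁ b₁ c) (t₂ : IsTriangle G A B C a₂ b₂ c) (ha : a₁ ≠ a₂)
    (hb : b₁ ≠ b₂) : False := by
  obtain ⟨ha₁, hb₁, hc, ab₁, bc₁, ac₁⟩ := t₁
  obtain ⟨ha₂, hb₂, -, ab₂, bc₂, ac₂⟩ := t₂
  have n1 := h.disj_left a₁ ha₁ b₁ hb₁
  have n2 := h.disj_left a₁ ha₁ b₂ hb₂
  have n3 := h.disj_left a₂ ha₂ b₁ hb₁
  have n4 := h.disj_left a₂ ha₂ b₂ hb₂
  have n5 := h.disj_right a₁ ha₁ c hc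
  have n6 := h.disj_right a₂ ha₂ c hc
  have n7 := h.disj_middle b₁ hb₁ c hc
  have n8 := h.disj_middle b₂ hb₂ c hc
  have hnd := h.nodup_map
    (l := [s(a₁, b₁), s(b₁, c), s(a₁, c), s(a₂, b₂), s(b₂, c), s(a₂, c)])
    (by simp only [List.nodup_cons, List.mem_cons, List.not_mem_nil, Sym2.eq_iff]; grind)
    (by simp [*])
  have e1 := h.left a₁ ha₁ a₂ ha₂ ha b₂ hb₂ c hc
  have e2 := h.middle b₁ hb₁ b₂ hb₂ hb a₁ ha₁ c hc
  rw [Sym2.eq_swap (a := b₁) (b := a₁), Sym2.eq_swap (a := b₂) (b := a₁)] at e2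
  simp only [List.map_cons, List.map_nil, List.nodup_cons, List.mem_cons, List.not_mem_nil,
    or_false] at hnd e1 e2
  grind

lemma IsRainbowSubgraph.triangle_disjoint_right (h : IsRainbowSubgraph G col A B C)
    (t₁ : IsTriangle G A B C a₁ b₁ c₁) (t₂ : IsTriangle G A B C a₂ b₂ c₂)
    (hne : a₁ ≠ a₂ ∨ b₁ ≠ b₂) : c₁ ≠ c₂ := by
  rintro rfl
  by_cases ha : a₁ = a₂
  · subst ha
    have := h.swap.eq_of_adj t₁.2 t₂.2 t₁.1 t₁.3 t₁.4.symm t₂.4.symm t₁.5 t₂.5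
    tauto
  by_cases hb : b₁ = b₂
  · subst hb
    exact ha (h.eq_of_adj t₁.1 t₂.1 t₁.2 t₁.3 t₁.4 t₂.4 t₁.6 t₂.6)
  exact h.false_of_common_vertex t₁ t₂ ha hb

/-- Distinct triangles of a rainbow subgraph are vertex-disjoint. -/
lemma IsRainbowSubgraph.triangle_disjoint (h : IsRainbowSubgraph G col A B C)
    (t₁ : IsTriangle G A B C a₁ b₁ c₁) (t₂ : IsTriangle G A B C a₂ b₂ c₂)
    (hne : b₁ ≠ b₂ ∨ c₁ ≠ c₂) : a₁ ≠ a₂ ∧ b₁ ≠ b₂ ∧ c₁ ≠ c₂ := by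
  have ha : a₁ ≠ a₂ := h.rotate.triangle_disjoint_right t₁.rotate t₂.rotate hne
  exact ⟨ha, h.rotate.rotate.triangle_disjoint_right t₁.rotate.rotate t₂.rotate.rotate (.inr ha),
    h.triangle_disjoint_right t₁ t₂ (.inl ha)⟩

/-- If one of the six edges between two disjoint triangles belongs to the rainbow subgraph, then all
six have the same colour. -/
lemma IsRainbowSubgraph.cross_eq (h : IsRainbowSubgraph G col A B C)
    (t₁ : IsTriangle G A B C a₁ b₁ c₁) (t₂ : IsTriangle G A B C a₂ b₂ c₂) (ha : a₁ ≠ a₂)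
    (hb : b₁ ≠ b₂) (hc : c₁ ≠ c₂) (hadj : G.Adj b₁ c₂) :
    (col s(a₁, b₂) = col s(b₁, c₂) ∧ col s(a₂, b₁) = col s(b₁, c₂)) ∧
    (col s(a₁, c₂) = col s(b₁, c₂) ∧ col s(a₂, c₁) = col s(b₁, c₂)) ∧
    col s(b₂, c₁) = col s(b₁, c₂) := by
  obtain ⟨ha₁, hb₁, hc₁, ab₁, bc₁, ac₁⟩ := t₁
  obtain ⟨ha₂, hb₂, hc₂, ab₂, bc₂, ac₂⟩ := t₂
  have n1 := h.disj_left a₁ ha₁ b₁ hb₁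
  have n2 := h.disj_left a₁ ha₁ b₂ hb₂
  have n3 := h.disj_left a₂ ha₂ b₁ hb₁
  have n4 := h.disj_left a₂ ha₂ b₂ hb₂
  have n5 := h.disj_right a₁ ha₁ c₁ hc₁
  have n6 := h.disj_right a₂ ha₂ c₁ hc₁
  have n7 := h.disj_right a₁ ha₁ c₂ hc₂
  have n8 := h.disj_right a₂ ha₂ c₂ hc₂
  have n9 := h.disj_middle b₁ hb₁ c₁ hc₁
  have n10 := h.disj_middle b₂ hb₂ c₁ hc₁
  have n11 := h.disj_middle b₁ hb₁ c₂ hc₂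
  have n12 := h.disj_middle b₂ hb₂ c₂ hc₂
  have hnd := h.nodup_map
    (l := [s(a₁, b₁), s(b₁, c₁), s(a₁, c₁), s(a₂, b₂), s(b₂, c₂), s(a₂, c₂), s(b₁, c₂)])
    (by simp only [List.nodup_cons, List.mem_cons, List.not_mem_nil, Sym2.eq_iff]; grind)
    (by simp [*])
  have A11 := h.left a₁ ha₁ a₂ ha₂ ha b₁ hb₁ c₁ hc₁
  have A12 := h.left a₁ ha₁ a₂ ha₂ ha b₁ hb₁ c₂ hc₂
  have A22 := h.left a₁ ha₁ a₂ ha₂ ha b₂ hb₂ c₂ hc₂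
  have B11 := h.middle b₁ hb₁ b₂ hb₂ hb a₁ ha₁ c₁ hc₁
  have B12 := h.middle b₁ hb₁ b₂ hb₂ hb a₁ ha₁ c₂ hc₂
  have B21 := h.middle b₁ hb₁ b₂ hb₂ hb a₂ ha₂ c₁ hc₁
  have B22 := h.middle b₁ hb₁ b₂ hb₂ hb a₂ ha₂ c₂ hc₂
  have C11 := h.right c₁ hc₁ c₂ hc₂ hc a₁ ha₁ b₁ hb₁
  have C12 := h.right c₁ hc₁ c₂ hc₂ hc a₁ ha₁ b₂ hb₂
  have C21 := h.right c₁ hc₁ c₂ hc₂ hc a₂ ha₂ b₁ hb₁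
  simp only [Sym2.eq_swap (a := b₁) (b := a₁), Sym2.eq_swap (a := b₂) (b := a₁),
    Sym2.eq_swap (a := b₁) (b := a₂), Sym2.eq_swap (a := b₂) (b := a₂)] at B11 B12 B21 B22
  simp only [Sym2.eq_swap (a := c₁), Sym2.eq_swap (a := c₂)] at C11 C12 C21
  simp only [List.map_cons, List.map_nil, List.nodup_cons, List.mem_cons, List.not_mem_nil,
    or_false] at hnd A11 A12 A22 B11 B12 B22 C11 C12 C21
  have hp : col s(a₁, b₂) = col s(a₁, b₁) ∨ col s(a₁, b₂) = col s(b₁, c₂) ∨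
      col s(a₁, b₂) = col s(b₂, c₂) := by clear * - hnd B12; grind
  have hp' : col s(a₂, b₁) = col s(b₁, c₂) ∨ col s(a₂, b₁) = col s(a₂, b₂) ∨
      col s(a₂, b₁) = col s(b₂, c₂) := by clear * - hnd B22; grind
  have hq : col s(a₁, c₂) = col s(b₁, c₁) ∨ col s(a₁, c₂) = col s(a₁, c₁) ∨
      col s(a₁, c₂) = col s(b₁, c₂) := by clear * - hnd C11; grind
  have hq' : col s(a₂, c₁) = col s(b₁, c₁) ∨ col s(a₂, c₁) = col s(b₁, c₂) ∨
      col s(a₂, c₁) = col s(a₂, c₂) := by clear * - hnd C21; grind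
  have hpq : col s(a₂, b₁) = col s(b₁, c₂) ∧ col s(a₁, c₂) = col s(b₁, c₂) := by
    clear * - hnd A12 hp' hq; grind
  obtain ⟨hp', hq⟩ := hpq
  have hq' : col s(a₂, c₁) = col s(b₁, c₂) := by clear * - hnd A11 hp' hq'; grind
  have hp : col s(a₁, b₂) = col s(b₁, c₂) := by clear * - hnd A22 hp hq; grind
  exact ⟨⟨hp, hp'⟩, ⟨hq, hq'⟩, by clear * - hnd B11 C12 hp hq; grind⟩

/-- A pair `(b, c)` of vertices is covered if it is an edge or has a common neighbour in `A`. -/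
def IsCovered (G : SimpleGraph W) (A : Finset W) (b c : W) : Prop :=
  G.Adj b c ∨ ∃ a ∈ A, G.Adj a b ∧ G.Adj a c

/-- If an edge `e` between two disjoint triangles in the rainbow subgraph covers `(b₁, c₂)`, or
completes a covering path through one of the triangles, then the six edges between the triangles
have the colour of `e`, which leaves no way to cover `(b₂, c₁)`. -/
lemma IsRainbowSubgraph.not_isCovered_of_cross (h : IsRainbowSubgraph G col A B C)
    (t₁ : IsTriangle G A B C a₁ b₁ c₁) (t₂ : IsTriangle G A B C a₂ b₂ c₂) (ha : a₁ ≠ a₂)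
    (hb : b₁ ≠ b₂) (hc : c₁ ≠ c₂) (hadj : G.Adj b₁ c₂ ∨ G.Adj a₁ c₂ ∨ G.Adj a₂ b₁) :
    ¬ IsCovered G A b₂ c₁ := by
  obtain ⟨e, he, hcross, e1, e2, e3, e4⟩ :
      ∃ e ∈ G.edgeSet, (e = s(b₁, c₂) ∨ e = s(a₁, c₂) ∨ e = s(a₂, b₁)) ∧
        col s(b₂, c₁) = col e ∧ col s(a₁, b₂) = col e ∧ col s(a₂, c₁) = col e ∧
        col s(a₂, b₁) = col e := by
    rcases hadj with hadj | hadj | hadj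
    · obtain ⟨⟨k1, k2⟩, ⟨k3, k4⟩, k5⟩ := h.cross_eq t₁ t₂ ha hb hc hadj
      exact ⟨_, hadj, .inl rfl, k5, k1, k4, k2⟩
    · obtain ⟨⟨k1, k2⟩, ⟨k3, k4⟩, k5⟩ := h.swap.cross_eq t₁.swap t₂.swap hb ha hc hadj
      rw [Sym2.eq_swap] at k1 k2
      exact ⟨_, hadj, .inr (.inl rfl), k4, k2, k5, k1⟩
    · obtain ⟨⟨k1, k2⟩, ⟨k3, k4⟩, k5⟩ := h.rotate.swap.cross_eq t₁.rotate.swap t₂.rotate.swap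
        hc hb ha hadj.symm
      simp only [Sym2.eq_swap (a := c₁), Sym2.eq_swap (a := b₁) (b := a₂),
        Sym2.eq_swap (a := b₂) (b := a₁)] at k1 k3 k5
      exact ⟨_, hadj, .inr (.inr rfl), k1, k5, k3, rfl⟩
  obtain ⟨ha₁, hb₁, hc₁, ab₁, bc₁, ac₁⟩ := t₁
  obtain ⟨ha₂, hb₂, hc₂, ab₂, bc₂, ac₂⟩ := t₂
  have n1 := h.disj_left a₁ ha₁ b₁ hb₁
  have n2 := h.disj_left a₁ ha₁ b₂ hb₂
  have n3 := h.disj_left a₂ ha₂ b₁ hb₁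
  have n4 := h.disj_left a₂ ha₂ b₂ hb₂
  have n5 := h.disj_right a₁ ha₁ c₁ hc₁
  have n6 := h.disj_right a₂ ha₂ c₁ hc₁
  have n7 := h.disj_right a₁ ha₁ c₂ hc₂
  have n8 := h.disj_right a₂ ha₂ c₂ hc₂
  have n9 := h.disj_middle b₁ hb₁ c₁ hc₁
  have n10 := h.disj_middle b₂ hb₂ c₁ hc₁
  have n11 := h.disj_middle b₁ hb₁ c₂ hc₂
  have n12 := h.disj_middle b₂ hb₂ c₂ hc₂
  rintro (hbc | ⟨a, haA, hab, hac⟩)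
  · have := h.injOn hbc he e1
    rw [← this] at hcross
    simp only [Sym2.eq_iff] at hcross
    grind
  by_cases h1 : a = a₁
  · subst h1
    have := h.injOn hab he e2
    rw [← this] at hcross
    simp only [Sym2.eq_iff] at hcross
    grind
  by_cases h2 : a = a₂
  · subst h2
    have := h.injOn hac he e3
    rw [← this] at hcross
    simp only [Sym2.eq_iff] at hcross
    grind
  have n13 := h.disj_left a haA b₂ hb₂
  have n14 := h.disj_right a haA c₁ hc₁
  refine h.left a₁ ha₁ a haA (Ne.symm h1) b₂ hb₂ c₁ hc₁ ?_
  rw [e2]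
  refine h.nodup_map (l := [e, s(a, b₂), s(a₁, c₁), s(a, c₁)]) ?_ (by simp [*])
  simp only [List.nodup_cons, List.mem_cons, List.not_mem_nil]
  rcases hcross with rfl | rfl | rfl <;> simp only [Sym2.eq_iff] <;> grind

/-- For two disjoint triangles of the rainbow subgraph, at least one of the pairs `(b₁, c₂)` and
`(b₂, c₁)` is uncovered. -/
lemma IsRainbowSubgraph.not_isCovered (h : IsRainbowSubgraph G col A B C)
    (t₁ : IsTriangle G A B C a₁ b₁ c₁) (t₂ : IsTriangle G A B C a₂ b₂ c₂) (ha : a₁ ≠ a₂)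
    (hb : b₁ ≠ b₂) (hc : c₁ ≠ c₂) : ¬ (IsCovered G A b₁ c₂ ∧ IsCovered G A b₂ c₁) := by
  rintro ⟨hcov, hcov'⟩
  have hin : ¬ (G.Adj b₁ c₂ ∨ G.Adj a₁ c₂ ∨ G.Adj a₂ b₁) := fun hadj =>
    h.not_isCovered_of_cross t₁ t₂ ha hb hc hadj hcov'
  have hin' : ¬ (G.Adj b₂ c₁ ∨ G.Adj a₂ c₁ ∨ G.Adj a₁ b₂) := fun hadj =>
    h.not_isCovered_of_cross t₂ t₁ ha.symm hb.symm hc.symm hadj hcov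
  simp only [not_or] at hin hin'
  -- both pairs are covered by paths through vertices `a`, `a'` outside the two triangles
  obtain ⟨a, haA, hab, hac⟩ := hcov.resolve_left hin.1
  obtain ⟨a', haA', hab', hac'⟩ := hcov'.resolve_left hin'.1
  have m1 : a ≠ a₁ := by rintro rfl; exact hin.2.1 hac
  have m2 : a ≠ a₂ := by rintro rfl; exact hin.2.2 hab
  have m3 : a' ≠ a₁ := by rintro rfl; exact hin'.2.2 hab'
  have m4 : a' ≠ a₂ := by rintro rfl; exact hin'.2.1 hac'
  obtain ⟨ha₁, hb₁, hc₁, ab₁, bc₁, ac₁⟩ := t₁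
  obtain ⟨ha₂, hb₂, hc₂, ab₂, bc₂, ac₂⟩ := t₂
  have n1 := h.disj_left a₁ ha₁
  have n2 := h.disj_left a₂ ha₂
  have n3 := h.disj_left a haA
  have n4 := h.disj_left a' haA'
  have n5 := h.disj_right a₁ ha₁
  have n6 := h.disj_right a₂ ha₂
  have n7 := h.disj_right a haA
  have n8 := h.disj_right a' haA'
  have n9 := h.disj_middle b₁ hb₁
  have n10 := h.disj_middle b₂ hb₂
  have hnd := h.nodup_map
    (l := [s(a₁, b₁), s(a₁, c₁), s(a₂, b₂), s(a₂, c₂), s(a, b₁), s(a, c₂), s(a', b₂), s(a', c₁)])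
    (by simp only [List.nodup_cons, List.mem_cons, List.not_mem_nil, Sym2.eq_iff]; grind)
    (by simp [*])
  have k1 := h.left a₂ ha₂ a haA m2.symm b₁ hb₁ c₂ hc₂
  have k2 := h.left a₂ ha₂ a' haA' m4.symm b₂ hb₂ c₁ hc₁
  have k3 := h.left a₁ ha₁ a₂ ha₂ ha b₁ hb₁ c₁ hc₁
  simp only [List.map_cons, List.map_nil, List.nodup_cons, List.mem_cons, List.not_mem_nil,
    or_false] at hnd k1 k2 k3
  clear * - hnd k1 k2 k3
  grind

/-! ### Sparsity of rainbow and of free subgraphs -/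

/-- The left side counts how often the pairs `(b, c)` are covered, which is at most twice. The pairs
covered twice belong to triangles, and all but one of these triangles are matched injectively with
uncovered pairs: combine the triangle with the remaining one and apply `not_isCovered`. -/
lemma IsRainbowSubgraph.edges_add_paths_le (h : IsRainbowSubgraph G col A B C) :
    edgesBetween G B C + ∑ a ∈ A, degInto G a B * degInto G a C ≤ #B * #C + 1 := by
  classical
  set f : W × W → ℕ := fun p => (if G.Adj p.1 p.2 then 1 else 0) + #(commonIn G A p.1 p.2) with hf
  have hsum : edgesBetween G B C + ∑ a ∈ A, degInto G a B * degInto G a C =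
      ∑ p ∈ B ×ˢ C, f p := by
    rw [sum_degInto_mul_degInto, hf, sum_add_distrib, sum_product, sum_product]
    simp only [edgesBetween, degInto, card_filter]
  have hcommon : ∀ b ∈ B, ∀ c ∈ C, #(commonIn G A b c) ≤ 1 := fun b hb c hc =>
    h.card_commonIn_le hb hc
  -- the pairs covered twice, and the uncovered ones
  set T := {p ∈ B ×ˢ C | f p = 2} with hT
  set Z := {p ∈ B ×ˢ C | f p = 0} with hZ
  have hle : ∀ p ∈ B ×ˢ C, f p ≤ 2 := by
    intro p hp
    have := hcommon p.1 (mem_product.1 hp).1 p.2 (mem_product.1 hp).2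
    simp only [hf]
    split_ifs <;> omega
  have hcount : ∑ p ∈ B ×ˢ C, f p + #Z = #B * #C + #T := by
    rw [hZ, hT, ← card_product, card_filter, card_filter, card_eq_sum_ones, ← sum_add_distrib,
      ← sum_add_distrib]
    refine sum_congr rfl fun p hp => ?_
    have := hle p hp
    split_ifs <;> omega
  have hcov : ∀ p ∈ B ×ˢ C, IsCovered G A p.1 p.2 ∨ p ∈ Z := by
    intro p hp
    by_contra! hcon
    refine hcon.2 (mem_filter.2 ⟨hp, ?_⟩)
    have h1 : ¬ G.Adj p.1 p.2 := fun h1 => hcon.1 (.inl h1)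
    have h2 : commonIn G A p.1 p.2 = ∅ := by
      refine filter_eq_empty_iff.2 fun a ha h2 => hcon.1 (.inr ⟨a, ha, h2.1.symm, h2.2.symm⟩)
    simp [hf, h1, h2]
  have htri : ∀ p ∈ T, ∃ a, IsTriangle G A B C a p.1 p.2 := by
    intro p hp
    obtain ⟨hp, hp2⟩ := mem_filter.1 hp
    rw [mem_product] at hp
    have := hcommon p.1 hp.1 p.2 hp.2
    simp only [hf] at hp2
    split_ifs at hp2 with hadj
    · obtain ⟨a, ha⟩ := card_pos.1 (show 0 < #(commonIn G A p.1 p.2) by omega)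
      simp only [commonIn, mem_filter] at ha
      exact ⟨a, ha.1, hp.1, hp.2, ha.2.1.symm, hadj, ha.2.2.symm⟩
    · omega
  have hTZ : #T ≤ #Z + 1 := by
    rcases T.eq_empty_or_nonempty with hT0 | ⟨p₀, hp₀⟩
    · simp [hT0]
    rw [← card_erase_add_one hp₀]
    refine Nat.add_le_add_right ?_ 1
    obtain ⟨a₀, t₀⟩ := htri p₀ hp₀
    have hdis : ∀ p ∈ T, ∀ q ∈ T, p ≠ q → p.1 ≠ q.1 ∧ p.2 ≠ q.2 := by
      intro p hp q hq hpq
      obtain ⟨a, t⟩ := htri p hp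
      obtain ⟨a', t'⟩ := htri q hq
      refine (h.triangle_disjoint t t' ?_).2
      by_contra! hcon
      exact hpq (Prod.ext hcon.1 hcon.2)
    refine card_le_card_of_injOn
      (fun p : W × W => if (p₀.1, p.2) ∈ Z then (p₀.1, p.2) else (p.1, p₀.2)) ?_ ?_
    · intro p hp
      obtain ⟨hne, hp⟩ := mem_erase.1 hp
      obtain ⟨a, t⟩ := htri p hp
      have hd := hdis p₀ hp₀ p hp hne.symm
      have hn := h.not_isCovered t₀ t (h.triangle_disjoint t₀ t (.inl hd.1)).1 hd.1 hd.2
      have c1 := hcov (p₀.1, p.2) (mem_product.2 ⟨t₀.2, t.3⟩)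
      have c2 := hcov (p.1, p₀.2) (mem_product.2 ⟨t.2, t₀.3⟩)
      dsimp only at c1 c2 ⊢
      split_ifs with hz
      · exact hz
      · exact c2.resolve_left fun c2 => hn ⟨c1.resolve_right hz, c2⟩
    · intro p hp q hq hpq
      obtain ⟨hnp, hp⟩ := mem_erase.1 hp
      obtain ⟨hnq, hq⟩ := mem_erase.1 hq
      by_contra hne
      have h1 := hdis p hp q hq hne
      have h2 := hdis p hp p₀ hp₀ hnp
      have h3 := hdis q hq p₀ hp₀ hnq
      dsimp only at hpq
      split_ifs at hpq <;> simp only [Prod.mk.injEq] at hpq <;> grind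
  omega

lemma IsRainbowSubgraph.sparseAt (h : IsRainbowSubgraph G col A B C) : SparseAt G 1 A B C where
  card_common_le _ hb _ hc := h.card_commonIn_le hb hc
  edges_add_paths_le _ hA _ hB _ hC := (h.mono hA hB hC).edges_add_paths_le

theorem IsRainbowSubgraph.sparse (h : IsRainbowSubgraph G col A B C) : Sparse G 1 A B C :=
  ⟨h.sparseAt, h.swap.sparseAt, h.rotate.rotate.sparseAt⟩

/-- Without triangles and multipartite `4`-cycles every pair `(b, c)` is covered at most once. -/
lemma sparseAt_zero
    (htri : ∀ a ∈ A, ∀ b ∈ B, ∀ c ∈ C, G.Adj a b → G.Adj a c → ¬ G.Adj b c)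
    (hC₄ : ∀ a ∈ A, ∀ a' ∈ A, a ≠ a' → ∀ b ∈ B, ∀ c ∈ C, G.Adj a b → G.Adj a' b →
      G.Adj a c → ¬ G.Adj a' c) : SparseAt G 0 A B C where
  card_common_le b hb c hc := by
    refine card_le_one.2 fun a ha a' ha' => ?_
    simp only [commonIn, mem_filter] at ha ha'
    by_contra hne
    exact hC₄ a ha.1 a' ha'.1 hne b hb c hc ha.2.1.symm ha'.2.1.symm ha.2.2.symm ha'.2.2.symm
  edges_add_paths_le A' hA B' hB C' hC := by
    classical
    rw [sum_degInto_mul_degInto, edgesBetween, ← sum_add_distrib, add_zero, ← smul_eq_mul]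
    refine sum_le_card_nsmul _ _ _ fun b hb => ?_
    rw [degInto, card_filter, ← sum_add_distrib, card_eq_sum_ones]
    refine sum_le_sum fun c hc => ?_
    split_ifs with hadj
    · rw [card_eq_zero.2, add_zero]
      refine filter_eq_empty_iff.2 fun a ha hac => ?_
      exact htri a (hA ha) b (hB hb) c (hC hc) hac.1.symm hac.2.symm hadj
    · rw [zero_add]
      refine card_le_one.2 fun a ha a' ha' => ?_
      simp only [commonIn, mem_filter] at ha ha'
      by_contra hne
      exact hC₄ a (hA ha.1) a' (hA ha'.1) hne b (hB hb) c (hC hc) ha.2.1.symm ha'.2.1.symm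
        ha.2.2.symm ha'.2.2.symm

end Graph

variable {V : Fin 3 → Type*}

/-! ### Copies of cycles as quadruples of vertices -/

/-- The colours of the edges, extended by `0` to all unordered pairs of vertices. -/
noncomputable def extendColouring (c : (completeTripartite V).edgeSet → ℕ) :
    Sym2 (Σ i, V i) → ℕ :=
  Function.extend Subtype.val c 0

lemma extendColouring_apply (c : (completeTripartite V).edgeSet → ℕ)
    (e : (completeTripartite V).edgeSet) : extendColouring c e = c e :=
  Subtype.val_injective.extend_apply c 0 e

lemma mem_edgeSet_cycleGraph_four (e : Sym2 (Fin 4)) :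
    e ∈ (cycleGraph 4).edgeSet ↔ e = s(0, 1) ∨ e = s(1, 2) ∨ e = s(2, 3) ∨ e = s(3, 0) := by
  induction e using Sym2.ind with
  | _ i j =>
    rw [mem_edgeSet, cycleGraph_adj]
    revert i j
    decide

lemma isRainbow_iff (c : (completeTripartite V).edgeSet → ℕ)
    (f : Copy (cycleGraph 4) (completeTripartite V)) :
    IsRainbow c f ↔ [extendColouring c s(f 0, f 1), extendColouring c s(f 1, f 2),
      extendColouring c s(f 2, f 3), extendColouring c s(f 3, f 0)].Nodup := by
  have hinj : IsRainbow c f ↔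
      Set.InjOn (fun e => extendColouring c (e.map f)) (cycleGraph 4).edgeSet := by
    rw [Set.injOn_iff_injective, IsRainbow]
    refine iff_of_eq (congrArg _ (funext fun e => ?_))
    exact (extendColouring_apply c _).symm
  rw [hinj]
  constructor
  · intro h
    refine List.Nodup.map_on (l := [s(0, 1), s(1, 2), s(2, 3), s(3, 0)])
      (f := fun e : Sym2 (Fin 4) => extendColouring c (e.map f)) ?_ (by decide)
    intro x hx y hy hxy
    exact h ((mem_edgeSet_cycleGraph_four x).2 (by simpa using hx))
      ((mem_edgeSet_cycleGraph_four y).2 (by simpa using hy)) hxy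
  · intro h x hx y hy hxy
    rw [mem_edgeSet_cycleGraph_four] at hx hy
    simp only [List.nodup_cons, List.mem_cons, List.not_mem_nil, or_false, not_or] at h
    rcases hx with rfl | rfl | rfl | rfl <;> rcases hy with rfl | rfl | rfl | rfl <;>
      simp only [Sym2.map_mk] at hxy <;> grind

/-- The `4`-cycle `a – b – a' – c` as a copy of the cycle graph. -/
def fourCycle {W : Type*} {G : SimpleGraph W} {a a' b c : W} (ha : a ≠ a') (hbc : b ≠ c)
    (hab : G.Adj a b) (hab' : G.Adj a' b) (hac : G.Adj a c) (hac' : G.Adj a' c) :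
    Copy (cycleGraph 4) G where
  toHom :=
    { toFun := ![a, b, a', c]
      map_rel' := by
        intro i j hij
        rw [cycleGraph_adj] at hij
        have := hab.symm
        have := hab'.symm
        have := hac.symm
        have := hac'.symm
        fin_cases i <;> fin_cases j <;> first | assumption | exact absurd hij (by decide) }
  injective' := by
    have := hab.ne
    have := hab'.ne
    have := hac.ne
    have := hac'.ne
    intro i j hij
    fin_cases i <;> fin_cases j <;> simp at hij ⊢ <;> grind

lemma isMultipartite_fourCycle {G : SimpleGraph (Σ i, V i)} {a a' b c : Σ i, V i} (ha : a ≠ a')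
    (hbc : b ≠ c) (hab : G.Adj a b) (hab' : G.Adj a' b) (hac : G.Adj a c) (hac' : G.Adj a' c)
    (h1 : a.1 ≠ b.1) (h2 : a.1 ≠ c.1) (h3 : b.1 ≠ c.1) :
    IsMultipartite (fourCycle ha hbc hab hab' hac hac') := by
  intro i
  have : a.1 = i ∨ b.1 = i ∨ c.1 = i := by omega
  rcases this with h | h | h
  · exact ⟨0, h⟩
  · exact ⟨1, h⟩
  · exact ⟨3, h⟩

/-- A multipartite `4`-cycle has two opposite vertices in one part, and the other two vertices lie
in the other two parts. -/
lemma IsMultipartite.parts {G : SimpleGraph (Σ i, V i)} (hG : G ≤ completeTripartite V)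
    {f : Copy (cycleGraph 4) G} (hf : IsMultipartite f) :
    ((f 0).1 = (f 2).1 ∧ (f 0).1 ≠ (f 1).1 ∧ (f 0).1 ≠ (f 3).1 ∧ (f 1).1 ≠ (f 3).1) ∨
    ((f 1).1 = (f 3).1 ∧ (f 1).1 ≠ (f 2).1 ∧ (f 1).1 ≠ (f 0).1 ∧ (f 2).1 ≠ (f 0).1) := by
  have key : ∀ p : Fin 4 → Fin 3, p 0 ≠ p 1 → p 1 ≠ p 2 → p 2 ≠ p 3 → p 3 ≠ p 0 →
      (∀ i, ∃ j, p j = i) → (p 0 = p 2 ∧ p 0 ≠ p 1 ∧ p 0 ≠ p 3 ∧ p 1 ≠ p 3) ∨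
        (p 1 = p 3 ∧ p 1 ≠ p 2 ∧ p 1 ≠ p 0 ∧ p 2 ≠ p 0) := by
    decide
  have hadj : ∀ i j : Fin 4, (cycleGraph 4).Adj i j → (f i).1 ≠ (f j).1 :=
    fun i j hij => hG (f.toHom.map_adj hij)
  refine key (fun j => (f j).1) (hadj 0 1 ?_) (hadj 1 2 ?_) (hadj 2 3 ?_) (hadj 3 0 ?_) hf <;>
    exact cycleGraph_adj.2 (by decide)

/-- A colouring has no rainbow multipartite `4`-cycle iff no cycle `a – b – a' – c` with `a`, `a'`
in the same part and `b`, `c` in the other two parts is rainbow. -/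
lemma not_exists_rainbow_iff (c : (completeTripartite V).edgeSet → ℕ) :
    (¬ ∃ f : Copy (cycleGraph 4) (completeTripartite V), IsMultipartite f ∧ IsRainbow c f) ↔
      ∀ a a' b d : Σ i, V i, a.1 = a'.1 → a ≠ a' → a.1 ≠ b.1 → a.1 ≠ d.1 → b.1 ≠ d.1 →
        ¬ [extendColouring c s(a, b), extendColouring c s(a', b), extendColouring c s(a, d),
          extendColouring c s(a', d)].Nodup := by
  constructor
  · intro h a a' b d hp hne h1 h2 h3 hnd
    refine h ⟨fourCycle hne (fun hbd => h3 (congrArg _ hbd)) h1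
      (hp.symm.trans_ne h1) h2 (hp.symm.trans_ne h2),
      isMultipartite_fourCycle _ _ _ _ _ _ h1 h2 h3, ?_⟩
    rw [isRainbow_iff]
    change [extendColouring c s(a, b), extendColouring c s(b, a'), extendColouring c s(a', d),
      extendColouring c s(d, a)].Nodup
    rw [Sym2.eq_swap (a := b), Sym2.eq_swap (a := d)]
    simp only [List.nodup_cons, List.mem_cons, List.not_mem_nil] at hnd ⊢
    grind
  · rintro h ⟨f, hf, hr⟩
    rw [isRainbow_iff] at hr
    simp only [List.nodup_cons, List.mem_cons, List.not_mem_nil] at h hr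
    rcases hf.parts le_rfl with ⟨hp, h1, h2, h3⟩ | ⟨hp, h1, h2, h3⟩
    · have := h (f 0) (f 2) (f 1) (f 3) hp (f.injective.ne (by decide)) h1 h2 h3
      rw [Sym2.eq_swap (a := f 2) (b := f 1), Sym2.eq_swap (a := f 0) (b := f 3)] at this
      grind
    · have := h (f 1) (f 3) (f 2) (f 0) hp (f.injective.ne (by decide)) h1 h2 h3
      rw [Sym2.eq_swap (a := f 3) (b := f 2), Sym2.eq_swap (a := f 1) (b := f 0)] at this
      grind

lemma not_exists_multipartite_iff {G : SimpleGraph (Σ i, V i)} (hG : G ≤ completeTripartite V) :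
    (¬ ∃ f : Copy (cycleGraph 4) G, IsMultipartite f) ↔
      ∀ a a' b d : Σ i, V i, a.1 = a'.1 → a ≠ a' → b.1 ≠ d.1 →
        G.Adj a b → G.Adj a' b → G.Adj a d → ¬ G.Adj a' d := by
  constructor
  · intro h a a' b d hp hne hbd hab hab' had had'
    exact h ⟨fourCycle hne (fun he => hbd (congrArg _ he)) hab hab' had had',
      isMultipartite_fourCycle _ _ _ _ _ _ (hG hab) (hG had) hbd⟩
  · rintro h ⟨f, hf⟩
    have hadj : ∀ i j : Fin 4, (cycleGraph 4).Adj i j → G.Adj (f i) (f j) :=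
      fun i j hij => f.toHom.map_adj hij
    have h01 := hadj 0 1 (cycleGraph_adj.2 (by decide))
    have h12 := hadj 1 2 (cycleGraph_adj.2 (by decide))
    have h23 := hadj 2 3 (cycleGraph_adj.2 (by decide))
    have h30 := hadj 3 0 (cycleGraph_adj.2 (by decide))
    rcases hf.parts hG with ⟨hp, h1, h2, h3⟩ | ⟨hp, h1, h2, h3⟩
    · exact h _ _ _ _ hp (f.injective.ne (by decide)) h3 h01 h12.symm h30.symm h23
    · exact h _ _ _ _ hp (f.injective.ne (by decide)) h3 h12 h23.symm h01.symm h30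

lemma free_cycleGraph_three_iff {W : Type*} (G : SimpleGraph W) :
    (cycleGraph 3).Free G ↔ ∀ a b c, G.Adj a b → G.Adj a c → ¬ G.Adj b c := by
  rw [cycleGraph_three_eq_top, ← cliqueFree_iff_top_free, Fintype.card_fin]
  constructor
  · intro h a b c hab hac hbc
    classical exact h {a, b, c} (is3Clique_triple_iff.2 ⟨hab, hac, hbc⟩)
  · intro h s hs
    classical
    obtain ⟨a, b, c, hab, hac, hbc, -⟩ := is3Clique_iff.1 hs
    exact h a b c hab hac hbc

/-! ### Upper bounds -/

section Bounds

variable [∀ i, Fintype (V i)]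

/-- The `i`-th part of the vertex set of the complete `3`-partite graph. -/
def part (V : Fin 3 → Type*) [∀ i, Fintype (V i)] (i : Fin 3) : Finset (Σ i, V i) :=
  univ.map (Function.Embedding.sigmaMk i)

lemma mem_part {i : Fin 3} {w : Σ i, V i} : w ∈ part V i ↔ w.1 = i := by
  constructor
  · rw [part, mem_map]
    rintro ⟨x, -, rfl⟩
    rfl
  · rintro rfl
    exact mem_map.2 ⟨w.2, mem_univ _, rfl⟩

lemma card_part (i : Fin 3) : #(part V i) = Fintype.card (V i) := by
  rw [part, card_map, card_univ]

open scoped Classical in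
lemma edgesBetween_eq_card {W : Type*} (G : SimpleGraph W) (A B : Finset W) :
    edgesBetween G A B = #{p ∈ A ×ˢ B | G.Adj p.1 p.2} := by
  simp only [edgesBetween, degInto, card_filter, sum_product]

lemma ncard_edgeSet_le {G : SimpleGraph (Σ i, V i)} (hG : G ≤ completeTripartite V) :
    G.edgeSet.ncard ≤ edgesAcross G (part V 0) (part V 1) (part V 2) := by
  classical
  set E : Fin 3 → Fin 3 → Finset (Sym2 (Σ i, V i)) := fun i j =>
    {p ∈ part V i ×ˢ part V j | G.Adj p.1 p.2}.image fun p => s(p.1, p.2) with hE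
  have hmem : ∀ {u v}, G.Adj u v → s(u, v) ∈ E u.1 v.1 := fun {u v} huv =>
    mem_image.2 ⟨(u, v), by simpa [mem_part] using huv, rfl⟩
  have key : ∀ i j, i ≠ j → ∀ e, e ∈ E i j → e ∈ E j i → e ∈ E 0 1 ∪ E 0 2 ∪ E 1 2 := by
    intro i j hij e h1 h2
    rw [mem_union, mem_union]
    clear_value E
    fin_cases i <;> fin_cases j <;> first
      | exact absurd rfl hij
      | exact .inl (.inl h1)
      | exact .inl (.inl h2)
      | exact .inl (.inr h1)
      | exact .inl (.inr h2)
      | exact .inr h1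
      | exact .inr h2
  have hsub : G.edgeSet ⊆ ↑(E 0 1 ∪ E 0 2 ∪ E 1 2) := by
    intro e
    induction e using Sym2.ind with
    | _ u v =>
      intro huv
      exact key u.1 v.1 (hG huv) _ (hmem huv) (Sym2.eq_swap ▸ hmem (G.adj_symm huv))
  calc G.edgeSet.ncard ≤ #(E 0 1 ∪ E 0 2 ∪ E 1 2) := by
        rw [← Set.ncard_coe_finset]
        exact Set.ncard_le_ncard hsub (Set.toFinite _)
    _ ≤ #(E 0 1) + #(E 0 2) + #(E 1 2) :=
      (card_union_le _ _).trans (by gcongr; exact card_union_le _ _)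
    _ ≤ _ := by
      simp only [edgesAcross, edgesBetween_eq_card]
      gcongr <;> exact card_image_le

/-- The upper bound for the anti-Ramsey number. -/
theorem ncard_range_le (h₀ : Fintype.card (V 2) ≤ Fintype.card (V 0))
    (h₁ : Fintype.card (V 2) ≤ Fintype.card (V 1)) {k : ℕ} (hk : k ∈ rainbowFreeColorCounts V) :
    k ≤ Fintype.card (V 0) * Fintype.card (V 1) + Fintype.card (V 2) + 1 := by
  obtain ⟨c, hc, rfl⟩ := hk
  rw [not_exists_rainbow_iff] at hc
  -- `G` consists of one edge of each colour
  obtain ⟨R, hR, hbij⟩ := (Set.surjOn_image (extendColouring c)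
    (completeTripartite V).edgeSet).exists_bijOn_subset
  have himage : extendColouring c '' (completeTripartite V).edgeSet = Set.range c := by
    rw [Set.image_eq_range]
    exact congrArg Set.range (funext fun e => extendColouring_apply c e)
  have hedge : (fromEdgeSet R).edgeSet = R := by
    rw [edgeSet_fromEdgeSet]
    refine sdiff_eq_left.2 (Set.disjoint_left.2 fun e he => ?_)
    exact not_isDiag_of_mem_edgeSet _ (hR he)
  have hG : fromEdgeSet R ≤ completeTripartite V := by
    rw [← edgeSet_subset_edgeSet, hedge]
    exact hR
  have hne : ∀ i j : Fin 3, i ≠ j → ∀ a ∈ part V i, ∀ b ∈ part V j, a ≠ b := by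
    rintro i j hij a ha b hb rfl
    exact hij ((mem_part.1 ha).symm.trans (mem_part.1 hb))
  have hfree : ∀ i j k : Fin 3, i ≠ j → i ≠ k → j ≠ k →
      RainbowFreeAt (extendColouring c) (part V i) (part V j) (part V k) := by
    intro i j k hij hik hjk a ha a' ha' hne b hb d hd
    rw [mem_part] at ha ha' hb hd
    subst hb hd ha
    exact hc a a' b d ha'.symm hne hij hik hjk
  have hrain : IsRainbowSubgraph (fromEdgeSet R) (extendColouring c) (part V 0) (part V 1)
      (part V 2) :=
    ⟨by rw [hedge]; exact hbij.injOn, hne 0 1 (by decide), hne 1 2 (by decide),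
      hne 0 2 (by decide), hfree 0 1 2 (by decide) (by decide) (by decide),
      hfree 1 0 2 (by decide) (by decide) (by decide),
      hfree 2 0 1 (by decide) (by decide) (by decide)⟩
  have hle := hrain.sparse.edgesAcross_le (by simpa only [card_part]) (by simpa only [card_part])
  simp only [card_part] at hle
  rw [← himage, ← hbij.image_eq, hbij.injOn.ncard_image, ← hedge]
  exact (ncard_edgeSet_le hG).trans hle

/-- The upper bound for the Turán number. -/
theorem ncard_edgeSet_le_of_free (h₀ : Fintype.card (V 2) ≤ Fintype.card (V 0))
    (h₁ : Fintype.card (V 2) ≤ Fintype.card (V 1)) {m : ℕ} (hm : m ∈ freeEdgeCounts V) :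
    m ≤ Fintype.card (V 0) * Fintype.card (V 1) + Fintype.card (V 2) := by
  obtain ⟨G, hG, htri, hC₄, rfl⟩ := hm
  rw [free_cycleGraph_three_iff] at htri
  rw [not_exists_multipartite_iff hG] at hC₄
  have hsparse : ∀ i j k : Fin 3, j ≠ k → SparseAt G 0 (part V i) (part V j) (part V k) := by
    intro i j k hjk
    refine sparseAt_zero (fun a _ b _ c _ => htri a b c) ?_
    intro a ha a' ha' hne b hb d hd
    rw [mem_part] at ha ha' hb hd
    exact hC₄ a a' b d (ha.trans ha'.symm) hne (by rwa [hb, hd])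
  have hle := Sparse.edgesAcross_le ⟨hsparse 0 1 2 (by decide), hsparse 1 0 2 (by decide),
    hsparse 2 0 1 (by decide)⟩ (by simpa only [card_part]) (by simpa only [card_part])
  simp only [card_part] at hle
  exact (ncard_edgeSet_le hG).trans hle

end Bounds

/-! ### Extremal constructions -/

/-- The colours `(x, y)` on the edges between the first two parts, `z` on the edges from the vertex
`z` of the third part to the first part, and one more colour between the last two parts. -/
def extremalColour : (Σ i, V i) → (Σ i, V i) → Option (V 0 × V 1 ⊕ V 2)
  | ⟨0, x⟩, ⟨1, y⟩ => some (.inl (x, y))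
  | ⟨1, y⟩, ⟨0, x⟩ => some (.inl (x, y))
  | ⟨0, _⟩, ⟨2, z⟩ => some (.inr z)
  | ⟨2, z⟩, ⟨0, _⟩ => some (.inr z)
  | _, _ => none

lemma extremalColour_comm (u v : Σ i, V i) : extremalColour u v = extremalColour v u := by
  obtain ⟨i, x⟩ := u
  obtain ⟨j, y⟩ := v
  fin_cases i <;> fin_cases j <;> rfl

/-- No multipartite `4`-cycle is rainbow in the colouring `extremalColour`: if `a`, `a'` lie in the
same part and `b`, `c` in the others, then the vertex among `b`, `c` in the third part (or, when `a`
and `a'` are there, the one in the second part) sends edges of one colour to `a` and `a'`. -/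
theorem mem_rainbowFreeColorCounts [∀ i, Fintype (V i)] [∀ i, Nonempty (V i)] :
    Fintype.card (V 0) * Fintype.card (V 1) + Fintype.card (V 2) + 1 ∈
      rainbowFreeColorCounts V := by
  obtain ⟨φ, hφ⟩ := exists_injective_nat (Option (V 0 × V 1 ⊕ V 2))
  set col : Sym2 (Σ i, V i) → ℕ :=
    fun e => φ (Sym2.lift ⟨extremalColour, extremalColour_comm⟩ e) with hcol
  refine ⟨fun e => col e, ?_, ?_⟩
  · rw [not_exists_rainbow_iff]
    have hext : ∀ u v : Σ i, V i, u.1 ≠ v.1 →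
        extendColouring (fun e => col e) s(u, v) = φ (extremalColour u v) := fun u v huv =>
      extendColouring_apply (fun e => col e) ⟨s(u, v), huv⟩
    rintro ⟨i, x⟩ ⟨i', x'⟩ ⟨j, y⟩ ⟨k, z⟩ hp hne h1 h2 h3
    dsimp only at hp h1 h2 h3
    subst hp
    rw [hext _ _ h1, hext _ _ h1, hext _ _ h2, hext _ _ h2]
    fin_cases i <;> fin_cases j <;> fin_cases k <;> simp_all [extremalColour]
  · have hrange : Set.range (fun e : (completeTripartite V).edgeSet => col e) = Set.range φ := by
      refine Set.Subset.antisymm ?_ ?_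
      · rintro _ ⟨e, rfl⟩
        exact ⟨_, rfl⟩
      · have hadj : ∀ u v : Σ i, V i, u.1 ≠ v.1 → φ (extremalColour u v) ∈
            Set.range (fun e : (completeTripartite V).edgeSet => col e) := fun u v huv =>
          ⟨⟨s(u, v), huv⟩, rfl⟩
        rintro _ ⟨_ | ⟨x, y⟩ | z, rfl⟩
        · exact hadj ⟨1, Classical.arbitrary _⟩ ⟨2, Classical.arbitrary _⟩ (show (1 : Fin 3) ≠ 2 by decide)
        · exact hadj ⟨0, x⟩ ⟨1, y⟩ (show (0 : Fin 3) ≠ 1 by decide)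
        · exact hadj ⟨0, Classical.arbitrary _⟩ ⟨2, z⟩ (show (0 : Fin 3) ≠ 2 by decide)
    rw [hrange, ← Set.image_univ, Set.ncard_image_of_injective _ hφ, Set.ncard_univ,
      Nat.card_eq_fintype_card]
    simp

/-- The complete bipartite graph between the first two parts, with every vertex of the third part
attached to the vertex `a` of the first part. -/
def extremalGraph (a : V 0) : SimpleGraph (Σ i, V i) :=
  SimpleGraph.fromRel fun u v => u.1 = 0 ∧ v.1 = 1 ∨ u = ⟨0, a⟩ ∧ v.1 = 2

lemma extremalGraph_adj (a : V 0) (u v : Σ i, V i) : (extremalGraph a).Adj u v ↔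
    (u.1 = 0 ∧ v.1 = 1 ∨ u = ⟨0, a⟩ ∧ v.1 = 2) ∨ (v.1 = 0 ∧ u.1 = 1 ∨ v = ⟨0, a⟩ ∧ u.1 = 2) := by
  rw [extremalGraph, fromRel_adj, and_iff_right_iff_imp]
  rintro h rfl
  rcases h with (h | h) | (h | h) <;> grind

theorem exists_mem_freeEdgeCounts [∀ i, Fintype (V i)] [Nonempty (V 0)] :
    ∃ m ∈ freeEdgeCounts V,
      Fintype.card (V 0) * Fintype.card (V 1) + Fintype.card (V 2) ≤ m := by
  obtain ⟨a⟩ := ‹Nonempty (V 0)›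
  have hle : extremalGraph a ≤ completeTripartite V := by
    intro u v huv
    rw [extremalGraph_adj] at huv
    change u.1 ≠ v.1
    grind
  refine ⟨_, ⟨extremalGraph a, hle, ?_, ?_, rfl⟩, ?_⟩
  · rw [free_cycleGraph_three_iff]
    intro u v w
    simp only [extremalGraph_adj]
    grind
  · rw [not_exists_multipartite_iff hle]
    intro u u' v w
    simp only [extremalGraph_adj]
    grind
  · set ψ : V 0 × V 1 ⊕ V 2 → Sym2 (Σ i, V i) :=
      Sum.elim (fun p => s(⟨0, p.1⟩, ⟨1, p.2⟩)) (fun z => s(⟨0, a⟩, ⟨2, z⟩)) with hψ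
    have hinj : Function.Injective ψ := by
      rintro (⟨x, y⟩ | z) (⟨x', y'⟩ | z') h <;> simp_all
    have hsub : Set.range ψ ⊆ (extremalGraph a).edgeSet := by
      rintro _ ⟨⟨x, y⟩ | z, rfl⟩
      · exact (extremalGraph_adj a _ _).2 (.inl (.inl ⟨rfl, rfl⟩))
      · exact (extremalGraph_adj a _ _).2 (.inl (.inr ⟨rfl, rfl⟩))
    have hcard := Set.ncard_le_ncard hsub (Set.toFinite _)
    rw [← Set.image_univ, Set.ncard_image_of_injective _ hinj, Set.ncard_univ,
      Nat.card_eq_fintype_card] at hcard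
    simpa using hcard

end TripartiteC4

theorem theorem3 (n₁ n₂ n₃ : ℕ) (h₁₂ : n₂ ≤ n₁) (h₂₃ : n₃ ≤ n₂) (h₃ : 1 ≤ n₃) :
    TripartiteC4.ar (fun i : Fin 3 => Fin (![n₁, n₂, n₃] i)) = n₁ * n₂ + n₃ + 1 ∧
      TripartiteC4.ar (fun i : Fin 3 => Fin (![n₁, n₂, n₃] i)) =
        TripartiteC4.ex (fun i : Fin 3 => Fin (![n₁, n₂, n₃] i)) + 1 := by
  set V : Fin 3 → Type := fun i => Fin (![n₁, n₂, n₃] i) with hV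
  have c₀ : Fintype.card (V 0) = n₁ := Fintype.card_fin _
  have c₁ : Fintype.card (V 1) = n₂ := Fintype.card_fin _
  have c₂ : Fintype.card (V 2) = n₃ := Fintype.card_fin _
  have hne : ∀ i, Nonempty (V i) := by
    intro i
    refine ⟨⟨0, ?_⟩⟩
    fin_cases i <;> simp <;> omega
  have har := TripartiteC4.ar_isGreatest V
  have hex := TripartiteC4.ex_isGreatest V
  have u₁ := TripartiteC4.ncard_range_le (V := V) (by omega) (by omega) har.1
  have l₁ := har.2 TripartiteC4.mem_rainbowFreeColorCounts
  have u₂ := TripartiteC4.ncard_edgeSet_le_of_free (V := V) (by omega) (by omega) hex.1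
  obtain ⟨m, hm, l₂⟩ := TripartiteC4.exists_mem_freeEdgeCounts (V := V)
  have l₃ := hex.2 hm
  rw [c₀, c₁, c₂] at u₁ l₁ u₂ l₂
  omega
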